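/- Let $d\in\mathbb N$ and $\sigma>0$, and consider the Gaussian \[ \Phi(x)=\frac{\sigma^d}{\pi^{d/2}}\exp(-\sigma^2\|x\|_2^2),\qquad x\in\mathbb R^d . \] Let $\mathbf P$ be the countable vector of differential operators whose entries are, for $k=0,1,2,\dots$, \[ \Bigl(\tfrac{1}{n!\,4^n\sigma^{2n}}\Bigr)^{1/2}\Delta^k\ \text{ with } n=2k, \qquad \Bigl(\tfrac{1}{n!\,4^n\sigma^{2n}}\Bigr)^{1/2}\Delta^k\frac{\partial}{\partial x_j},\ j=1,\dots,d,\ \text{ with } n=2k+1 \] (the latter being the components of $(n!\,4^n\sigma^{2n})^{-1/2}\Delta^k\nabla$), all derivatives being taken in the sense of tempered distributions; enumerate the entries as $P_1,P_2,\dots$. Let \[ H_{\mathbf P}(\mathbb R^d)=\Bigl\{f\in L_2(\mathbb R^d)\text{ real-valued}:\ P_if\in L_2(\mathbb R^d)\text{ for all } i,\ \sum_i\|P_if\|_{L_2}^2<\infty\Bigr\}, \qquad (f,g)_{H_{\mathbf P}}=\sum_i\int_{\mathbb R^d}(P_if)(x)\overline{(P_ig)(x)}\,dx . \] Then $\Phi$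 is positive definite (continuous, even, and $\sum_{j,k=1}^N c_jc_k\Phi(x_j-x_k)>0$ for all pairwise distinct $x_1,\dots,x_N\in\mathbb R^d$ and all $c\in\mathbb R^N\setminus\{0\}$), so that there is a real reproducing-kernel Hilbert space $\mathcal N_\Phi$ of functions on $\mathbb R^d$ with reproducing kernel $K(x,y)=\Phi(x-y)$, and $\mathcal N_\Phi$ coincides with $H_{\mathbf P}(\mathbb R^d)$, with equal inner products (hence equal norms): every element of $\mathcal N_\Phi$ is a continuous function, the map sending $f\in\mathcal N_\Phi$ to its almost-everywhere class is a linear bijection of $\mathcal N_\Phi$ onto $H_{\mathbf P}(\mathbb R^d)$, and \[ (f,g)_{\mathcal N_\Phi}=(f,g)_{H_{\mathbf P}}\qquad\text{for all } f,g\in\mathcal N_\Phi . \] -/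

import Mathlib

open MeasureTheory SchwartzMap
open scoped ENNReal

noncomputable section

/-- The Euclidean space `ℝ^d`. -/
abbrev Euc (d : ℕ) : Type := EuclideanSpace ℝ (Fin d)

/-! ### Positive definite functions and the Gaussian -/

/-- Positive definite functions on `ℝ^d`: continuous even real functions `Φ` such that
`∑ⱼ ∑ₖ cⱼ cₖ Φ (xⱼ - xₖ) > 0` for all pairwise distinct `x₁, …, x_N` and all nonzero `c ∈ ℝ^N`. -/
structure IsPositiveDefiniteFunction {d : ℕ} (Φ : Euc d → ℝ) : Prop where
  continuous : Continuous Φ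
  even : ∀ x, Φ (-x) = Φ x
  pos : ∀ (N : ℕ) (x : Fin N → Euc d), Function.Injective x → ∀ c : Fin N → ℝ, c ≠ 0 →
    0 < ∑ j, ∑ k, c j * c k * Φ (x j - x k)

/-- The Gaussian function `Φ(x) = σ^d π^{-d/2} exp(-σ² ‖x‖²)`. -/
def gaussianFun (d : ℕ) (σ : ℝ) (x : Euc d) : ℝ :=
  σ ^ d / Real.pi ^ ((d : ℝ) / 2) * Real.exp (-σ ^ 2 * ‖x‖ ^ 2)

/-- The translation invariant kernel `K(x, y) = Φ(x - y)`, a matrix indexed by `ℝ^d`; its entries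
are scalars, seen as linear maps `ℝ → ℝ`. -/
def translationKernel {d : ℕ} (Φ : Euc d → ℝ) : Matrix (Euc d) (Euc d) (ℝ →L[ℝ] ℝ) :=
  Matrix.of fun x y => Φ (x - y) • ContinuousLinearMap.id ℝ ℝ

/-! ### Differential operators on tempered distributions -/

/-- The distributional partial derivative `∂/∂xⱼ : 𝓢' → 𝓢'`. -/
def partialDeriv (d : ℕ) (j : Fin d) : Module.End ℂ 𝓢'(Euc d, ℂ) :=
  (LineDeriv.lineDerivOpCLM ℂ 𝓢'(Euc d, ℂ)
    (EuclideanSpace.single j (1 : ℝ) : Euc d)).toLinearMap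

/-- The differential operators with real constant coefficients acting on tempered distributions,
i.e. the finite real linear combinations of the distributional derivatives `D^α`: the real algebra
of operators generated by the partial derivatives. -/
def diffOps (d : ℕ) : Subalgebra ℝ (Module.End ℂ 𝓢'(Euc d, ℂ)) :=
  Algebra.adjoin ℝ (Set.range (partialDeriv d))

namespace diffOps

/-- The partial derivative `∂/∂xⱼ` as a differential operator. -/
def partialD {d : ℕ} (j : Fin d) : diffOps d :=
  ⟨partialDeriv d j, Algebra.subset_adjoin ⟨j, rfl⟩⟩

/-- The Laplace operator `Δ = ∑ⱼ ∂²/∂xⱼ²` as a differential operator. -/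
def laplace (d : ℕ) : diffOps d := ∑ j, partialD j ^ 2

end diffOps

/-! ### Generalized Sobolev spaces -/

/-- The tempered distribution `γ ↦ ∫ f γ` of a real function `f ∈ L²(ℝ^d)`. -/
def realToDistr {d : ℕ} (f : Lp ℝ 2 (volume : Measure (Euc d))) : 𝓢'(Euc d, ℂ) :=
  Lp.toTemperedDistributionCLM ℂ volume 2 (Complex.ofRealCLM.compLp f)

theorem realToDistr_apply {d : ℕ} (f : Lp ℝ 2 (volume : Measure (Euc d))) (γ : 𝓢(Euc d, ℂ)) :
    realToDistr f γ = ∫ x, γ x * (f x : ℂ) := by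
  rw [realToDistr, Lp.toTemperedDistributionCLM_apply, Lp.toTemperedDistribution_apply]
  refine integral_congr_ae ?_
  filter_upwards [Complex.ofRealCLM.coeFn_compLp f] with x hx
  simp [hx]

theorem realToDistr_zero {d : ℕ} :
    realToDistr (0 : Lp ℝ 2 (volume : Measure (Euc d))) = 0 := by
  have h : Complex.ofRealCLM.compLp (0 : Lp ℝ 2 (volume : Measure (Euc d))) = 0 :=
    map_zero (Complex.ofRealCLM.compLpL 2 (volume : Measure (Euc d)))
  rw [realToDistr, h, map_zero]

theorem realToDistr_add {d : ℕ} (f g : Lp ℝ 2 (volume : Measure (Euc d))) :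
    realToDistr (f + g) = realToDistr f + realToDistr g := by
  have h : Complex.ofRealCLM.compLp (f + g) =
      Complex.ofRealCLM.compLp f + Complex.ofRealCLM.compLp g :=
    map_add (Complex.ofRealCLM.compLpL 2 (volume : Measure (Euc d))) f g
  rw [realToDistr, h, map_add]; rfl

theorem realToDistr_smul {d : ℕ} (c : ℝ) (f : Lp ℝ 2 (volume : Measure (Euc d))) :
    realToDistr (c • f) = (c : ℂ) • realToDistr f := by
  have h : Complex.ofRealCLM.compLp (c • f) = (c : ℂ) • Complex.ofRealCLM.compLp f := by
    refine Lp.ext ?_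
    filter_upwards [Complex.ofRealCLM.coeFn_compLp (c • f), Complex.ofRealCLM.coeFn_compLp f,
      Lp.coeFn_smul c f, Lp.coeFn_smul (c : ℂ) (Complex.ofRealCLM.compLp f)] with x h₁ h₂ h₃ h₄
    rw [h₁, h₃, h₄, Pi.smul_apply, Pi.smul_apply, h₂]
    simp
  rw [realToDistr, h, map_smul]; rfl

/-- The function `g ∈ L²(ℝ^d)` that represents the tempered distribution `T`, if there is one
(it is then unique); otherwise `0`. -/
def l2Rep {d : ℕ} (T : 𝓢'(Euc d, ℂ)) : Lp ℂ 2 (volume : Measure (Euc d)) :=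
  open Classical in
  if h : ∃ g : Lp ℂ 2 (volume : Measure (Euc d)), Lp.toTemperedDistributionCLM ℂ volume 2 g = T
  then h.choose else 0

theorem l2Rep_toTemperedDistribution {d : ℕ} (g : Lp ℂ 2 (volume : Measure (Euc d))) :
    l2Rep (Lp.toTemperedDistributionCLM ℂ volume 2 g) = g := by
  have h : ∃ g' : Lp ℂ 2 (volume : Measure (Euc d)), Lp.toTemperedDistributionCLM ℂ volume 2 g' =
    Lp.toTemperedDistributionCLM ℂ volume 2 g := ⟨g, rfl⟩
  rw [l2Rep, dif_pos h]
  exact LinearMap.ker_eq_bot.mp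
    (Lp.ker_toTemperedDistributionCLM_eq_bot (F := ℂ) (μ := (volume : Measure (Euc d))) (p := 2))
    h.choose_spec

/-- The real generalized Sobolev space `H_P(ℝ^d)` of a countable family `P` of differential
operators: the real `f ∈ L²(ℝ^d)` with `P i f ∈ L²(ℝ^d)` (in the sense of tempered distributions)
for all `i`, and `∑ᵢ ‖P i f‖² < ∞`. -/
def genSobolev {d : ℕ} {ι : Type} [Countable ι] (P : ι → diffOps d) :
    Submodule ℝ (Lp ℝ 2 (volume : Measure (Euc d))) where
  carrier := {f | ∃ g : ι → Lp ℂ 2 (volume : Measure (Euc d)),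
    (∀ i, Lp.toTemperedDistributionCLM ℂ volume 2 (g i) =
      (P i : Module.End ℂ 𝓢'(Euc d, ℂ)) (realToDistr f)) ∧
    Summable fun i => ‖g i‖ ^ 2}
  zero_mem' := ⟨0, fun i => by
    rw [Pi.zero_apply, map_zero, realToDistr_zero, map_zero], by simp⟩
  add_mem' := by
    rintro f₁ f₂ ⟨g₁, h₁, s₁⟩ ⟨g₂, h₂, s₂⟩
    refine ⟨g₁ + g₂, fun i => by
      rw [Pi.add_apply, map_add, h₁, h₂, realToDistr_add, map_add], ?_⟩
    refine Summable.of_nonneg_of_le (fun i => by positivity) (fun i => ?_)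
      ((s₁.add s₂).mul_left 2)
    have h := norm_add_le (g₁ i) (g₂ i)
    rw [Pi.add_apply]
    nlinarith [sq_nonneg (‖g₁ i‖ - ‖g₂ i‖), norm_nonneg (g₁ i + g₂ i)]
  smul_mem' := by
    rintro c f ⟨g, h, s⟩
    refine ⟨fun i => (c : ℂ) • g i, fun i => by
      rw [map_smul, h, realToDistr_smul, map_smul], ?_⟩
    have e : (fun i => ‖(c : ℂ) • g i‖ ^ 2) = fun i => ‖(c : ℂ)‖ ^ 2 * ‖g i‖ ^ 2 := by
      funext i
      rw [norm_smul, mul_pow]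
    rw [e]
    exact s.mul_left _

/-- The semi-inner product `(f, g)_{H_P} = ∑ᵢ ∫ (P i f)(x) * conj ((P i g)(x)) dx` on `H_P(ℝ^d)`. -/
def genSobolevInner {d : ℕ} {ι : Type} [Countable ι] (P : ι → diffOps d)
    (f g : genSobolev P) : ℂ :=
  ∑' i, ∫ x, l2Rep ((P i : Module.End ℂ 𝓢'(Euc d, ℂ)) (realToDistr f.1)) x *
    (starRingEnd ℂ) (l2Rep ((P i : Module.End ℂ 𝓢'(Euc d, ℂ)) (realToDistr g.1)) x)

/-! ### The vector differential operator of the Gaussian -/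

/-- The coefficient `(1 / (n! 4^n σ^{2n}))^{1/2}`. -/
def gaussianCoeff (σ : ℝ) (n : ℕ) : ℝ :=
  √(1 / ((n.factorial : ℝ) * 4 ^ n * σ ^ (2 * n)))

/-- The countable vector `P` of the operators `(n! 4^n σ^{2n})^{-1/2} Δ^k` with `n = 2k`, and of
the components `(n! 4^n σ^{2n})^{-1/2} Δ^k ∂/∂xⱼ` of `(n! 4^n σ^{2n})^{-1/2} Δ^k ∇` with
`n = 2k + 1`, over all `k ∈ ℕ` and `j`. -/
def gaussianOps (d : ℕ) (σ : ℝ) : ℕ ⊕ (ℕ × Fin d) → diffOps d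
  | Sum.inl k => gaussianCoeff σ (2 * k) • diffOps.laplace d ^ k
  | Sum.inr (k, j) =>
      gaussianCoeff σ (2 * k + 1) • (diffOps.laplace d ^ k * diffOps.partialD j)

end

/-! Everything is compared on the frequency side. Put `w = gaussianWeight`, so that `w ^ 2` is the
Fourier transform of `Φ`. The weighted characters `ξ ↦ exp (-2πi⟨ξ, x⟩) w ξ` in `L²` then have Gram
matrix `Φ (x - y)`, and they are linearly independent because distinct characters are. This gives
positive definiteness. It also gives, for any Hilbert space `H` with kernel `Φ (x - y)`, an isometry
`T : H → L²` with `h = 𝓕⁻ (w * T h)` (`exists_gaussian_embedding`).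

The operators `P i` act on the Fourier side as multiplication by symbols `p i`. Their coefficients
are such that `∑ ‖p i‖ ^ 2` is the power series of `exp (π² ‖ξ‖ ^ 2 / σ ^ 2)`, which equals `w⁻²`
(`hasSum_norm_gaussianSymbol_sq`). Hence `H_P` consists of the real `f` with `𝓕 f = w * u`, `u ∈
L²`, and its inner product is that of the functions `u` (`exists_eq_fourierInv_weightMul`,
`genSobolevInner_eq`). Both spaces are thus described by the same formula; the adjoint of `T`
recovers an element of `H` from `u`. -/

noncomputable section

open scoped FourierTransform RealInnerProductSpace ComplexInnerProductSpace ContDiff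

/-! ### `L²` functions as tempered distributions; the Fourier integral -/

/-- Two locally integrable functions with the same integrals against all Schwartz functions agree
almost everywhere. -/
theorem ae_eq_of_integral_schwartz_mul_eq {d : ℕ} {f g : Euc d → ℂ} (hf : LocallyIntegrable f)
    (hg : LocallyIntegrable g) (h : ∀ γ : 𝓢(Euc d, ℂ), ∫ x, γ x * f x = ∫ x, γ x * g x) :
    f =ᵐ[volume] g := by
  refine ae_eq_of_integral_contDiff_smul_eq hf hg fun γ hγ hc => ?_
  have hc' : HasCompactSupport (Complex.ofRealCLM ∘ γ) := hc.comp_left rfl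
  have hγ' : ContDiff ℝ ∞ (Complex.ofRealCLM ∘ γ) := by fun_prop
  simpa using h (hc'.toSchwartzMap hγ')

/-- The inverse transform is the Fourier integral of the bilinear form `-⟨·, ·⟩`. This form is its
own flip, so the general Fubini identity becomes symmetric. -/
theorem integral_fourierInv_mul_eq {d : ℕ} {f g : Euc d → ℂ} (hf : Integrable f)
    (hg : Integrable g) : ∫ x, 𝓕⁻ f x * g x = ∫ x, f x * 𝓕⁻ g x := by
  have h := VectorFourier.integral_fourierIntegral_smul_eq_flip (L := -innerₗ (Euc d))
    (μ := volume) (ν := volume) Real.continuous_fourierChar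
    (by simp only [LinearMap.neg_apply]; exact continuous_inner.neg) hf hg
  have e : (-innerₗ (Euc d)).flip = -innerₗ (Euc d) := by
    ext x y
    simp [real_inner_comm]
  rw [e] at h
  simpa [VectorFourier.fourierIntegral, Real.fourierInv_eq] using h

theorem continuous_fourierInv_of_integrable {d : ℕ} {f : Euc d → ℂ} (hf : Integrable f) :
    Continuous (𝓕⁻ f) := by
  have h := VectorFourier.fourierIntegral_continuous (L := -innerₗ (Euc d))
    (μ := volume) Real.continuous_fourierChar
    (by simp only [LinearMap.neg_apply]; exact continuous_inner.neg) hf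
  refine h.congr fun x => ?_
  simp [VectorFourier.fourierIntegral, Real.fourierInv_eq]

/-- On `L¹ ∩ L²`, the inverse Fourier transform of `L²` is given by the Fourier integral. -/
theorem coeFn_fourierInv_ae_eq {d : ℕ} (q : Lp ℂ 2 (volume : Measure (Euc d)))
    (hq : Integrable q) : ((𝓕⁻ q : Lp ℂ 2 (volume : Measure (Euc d))) : Euc d → ℂ) =ᵐ[volume]
      𝓕⁻ (q : Euc d → ℂ) := by
  refine ae_eq_of_integral_schwartz_mul_eq ((Lp.memLp _).locallyIntegrable (by simp))
    (continuous_fourierInv_of_integrable hq).locallyIntegrable fun γ => ?_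
  have h := DFunLike.congr_fun (Lp.fourierInv_toTemperedDistribution_eq q) γ
  rw [TemperedDistribution.fourierInv_apply, Lp.toTemperedDistribution_apply,
    Lp.toTemperedDistribution_apply] at h
  simp only [smul_eq_mul] at h
  rw [← h, ← integral_fourierInv_mul_eq γ.integrable hq, SchwartzMap.fourierInv_coe]

/-- Turns a distributional product into a pointwise one. Since `p` may be unbounded, `p * q` is only
locally integrable, which suffices for testing against Schwartz functions. -/
theorem toTemperedDistribution_eq_smulLeftCLM_iff {d : ℕ} {p : Euc d → ℂ}
    (hp : p.HasTemperateGrowth) (r q : Lp ℂ 2 (volume : Measure (Euc d))) :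
    (r : 𝓢'(Euc d, ℂ)) = TemperedDistribution.smulLeftCLM ℂ p q ↔
      (r : Euc d → ℂ) =ᵐ[volume] fun x => p x * q x := by
  have key : ∀ γ : 𝓢(Euc d, ℂ), TemperedDistribution.smulLeftCLM ℂ p (q : 𝓢'(Euc d, ℂ)) γ =
      ∫ x, γ x * (p x * q x) := by
    intro γ
    rw [TemperedDistribution.smulLeftCLM_apply_apply, Lp.toTemperedDistribution_apply]
    refine integral_congr_ae (Filter.Eventually.of_forall fun x => ?_)
    simp only [SchwartzMap.smulLeftCLM_apply_apply hp, smul_eq_mul]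
    ring
  constructor
  · intro h
    refine ae_eq_of_integral_schwartz_mul_eq ((Lp.memLp _).locallyIntegrable (by simp)) ?_
      fun γ => ?_
    · have hq : LocallyIntegrable (q : Euc d → ℂ) := (Lp.memLp _).locallyIntegrable (by simp)
      exact hq.continuous_smul hp.1.continuous
    · rw [← key, ← h, Lp.toTemperedDistribution_apply]; rfl
  · intro h
    ext γ
    rw [key, Lp.toTemperedDistribution_apply]
    refine integral_congr_ae ?_
    filter_upwards [h] with x hx
    simp [hx]

/-! ### Fourier symbols of differential operators -/

/-- The operator `A` acts on the Fourier side as multiplication by `p`. -/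
structure HasFourierSymbol {d : ℕ} (A : Module.End ℂ 𝓢'(Euc d, ℂ)) (p : Euc d → ℂ) : Prop where
  hasTemperateGrowth : p.HasTemperateGrowth
  fourier_apply : ∀ T, 𝓕 (A T) = TemperedDistribution.smulLeftCLM ℂ p (𝓕 T)

namespace HasFourierSymbol

variable {d : ℕ} {A B : Module.End ℂ 𝓢'(Euc d, ℂ)} {p q : Euc d → ℂ}

theorem one : HasFourierSymbol (1 : Module.End ℂ 𝓢'(Euc d, ℂ)) 1 where
  hasTemperateGrowth := Function.HasTemperateGrowth.const 1
  fourier_apply T := by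
    have h := TemperedDistribution.smulLeftCLM_const (E := Euc d) (1 : ℂ) (𝓕 T)
    rw [one_smul] at h
    exact h.symm

theorem mul (hA : HasFourierSymbol A p) (hB : HasFourierSymbol B q) :
    HasFourierSymbol (A * B) (p * q) where
  hasTemperateGrowth := hA.1.mul hB.1
  fourier_apply T := by
    rw [Module.End.mul_apply, hA.2, hB.2,
      TemperedDistribution.smulLeftCLM_smulLeftCLM_apply hB.1 hA.1, mul_comm]

theorem pow (hA : HasFourierSymbol A p) (n : ℕ) : HasFourierSymbol (A ^ n) (p ^ n) := by
  induction n with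
  | zero => simpa using one
  | succ n ih => simpa only [pow_succ] using ih.mul hA

theorem real_smul (c : ℝ) (hA : HasFourierSymbol A p) :
    HasFourierSymbol (c • A) ((c : ℂ) • p) where
  hasTemperateGrowth := by
    have h : ((c : ℂ) • p) = (fun _ => (c : ℂ)) * p := by ext; simp
    rw [h]
    exact (Function.HasTemperateGrowth.const _).mul hA.1
  fourier_apply T := by
    rw [TemperedDistribution.smulLeftCLM_smul hA.1]
    have : (c • A) T = (c : ℂ) • A T := rfl
    rw [this, FourierTransform.fourier_smul, hA.2]
    rfl

theorem sum {ι : Type*} {s : Finset ι} {A : ι → Module.End ℂ 𝓢'(Euc d, ℂ)} {p : ι → Euc d → ℂ}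
    (h : ∀ i ∈ s, HasFourierSymbol (A i) (p i)) :
    HasFourierSymbol (∑ i ∈ s, A i) (fun x => ∑ i ∈ s, p i x) where
  hasTemperateGrowth := Function.HasTemperateGrowth.sum fun i hi => (h i hi).1
  fourier_apply T := by
    rw [TemperedDistribution.smulLeftCLM_sum fun i hi => (h i hi).1, LinearMap.sum_apply,
      _root_.sum_apply]
    have := map_sum (FourierTransform.fourierCLM ℂ 𝓢'(Euc d, ℂ)) (fun i => A i T) s
    simp only [FourierTransform.fourierCLM_apply] at this
    rw [this]
    exact Finset.sum_congr rfl fun i hi => (h i hi).2 T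

theorem partialDeriv (j : Fin d) :
    HasFourierSymbol (partialDeriv d j) (fun ξ => 2 * Real.pi * Complex.I * ξ j) where
  hasTemperateGrowth := by
    have h : (fun ξ : Euc d => ξ j).HasTemperateGrowth :=
      (EuclideanSpace.proj j : Euc d →L[ℝ] ℝ).hasTemperateGrowth
    fun_prop
  fourier_apply T := by
    have h : (fun ξ : Euc d => inner ℝ ξ (EuclideanSpace.single j (1 : ℝ))).HasTemperateGrowth := by
      fun_prop
    have e := TemperedDistribution.fourier_lineDerivOp_eq T (EuclideanSpace.single j (1 : ℝ))
    rw [← _root_.smul_apply, ← TemperedDistribution.smulLeftCLM_smul (by fun_prop)] at e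
    refine e.trans ?_
    congr 2
    ext ξ
    simp [EuclideanSpace.inner_single_right]

/-- On the level of `L²`, `A f = g` holds iff the Fourier transforms are related by the symbol. -/
theorem apply_eq_iff (hA : HasFourierSymbol A p) (f g : Lp ℂ 2 (volume : Measure (Euc d))) :
    (g : 𝓢'(Euc d, ℂ)) = A (f : 𝓢'(Euc d, ℂ)) ↔
      ((𝓕 g : Lp ℂ 2 (volume : Measure (Euc d))) : Euc d → ℂ) =ᵐ[volume]
        fun ξ => p ξ * (𝓕 f : Lp ℂ 2 (volume : Measure (Euc d))) ξ := by
  rw [← toTemperedDistribution_eq_smulLeftCLM_iff hA.1, ← Lp.fourier_toTemperedDistribution_eq,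
    ← Lp.fourier_toTemperedDistribution_eq, ← hA.2]
  constructor
  · intro h; rw [h]
  · intro h
    have := congrArg (fun T => 𝓕⁻ T) h
    simpa using this

end HasFourierSymbol

/-! ### The symbols of the Gaussian operators and their square sum -/

/-- The symbols of the operators `gaussianOps d σ`. -/
def gaussianSymbol (d : ℕ) (σ : ℝ) : ℕ ⊕ (ℕ × Fin d) → Euc d → ℂ
  | Sum.inl k => fun ξ => gaussianCoeff σ (2 * k) * (∑ j, (2 * Real.pi * Complex.I * ξ j) ^ 2) ^ k
  | Sum.inr (k, j) => fun ξ => gaussianCoeff σ (2 * k + 1) *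
      ((∑ j, (2 * Real.pi * Complex.I * ξ j) ^ 2) ^ k * (2 * Real.pi * Complex.I * ξ j))

theorem hasFourierSymbol_laplace_pow (d k : ℕ) :
    HasFourierSymbol ((diffOps.laplace d ^ k : diffOps d) : Module.End ℂ 𝓢'(Euc d, ℂ))
      (fun ξ => (∑ j, (2 * Real.pi * Complex.I * ξ j) ^ 2) ^ k) := by
  have h := (HasFourierSymbol.sum (s := Finset.univ)
    fun (j : Fin d) _ => (HasFourierSymbol.partialDeriv j).pow 2).pow k
  simp only [diffOps.laplace, diffOps.partialD, SubmonoidClass.coe_pow, AddSubmonoidClass.coe_finsetSum]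
  exact h

theorem hasFourierSymbol_gaussianOps (d : ℕ) (σ : ℝ) (i : ℕ ⊕ (ℕ × Fin d)) :
    HasFourierSymbol (gaussianOps d σ i : Module.End ℂ 𝓢'(Euc d, ℂ)) (gaussianSymbol d σ i) := by
  rcases i with k | ⟨k, j⟩
  · exact (hasFourierSymbol_laplace_pow d k).real_smul _
  · exact ((hasFourierSymbol_laplace_pow d k).mul (HasFourierSymbol.partialDeriv j)).real_smul _

theorem norm_sum_sq_symbol {d : ℕ} (ξ : Euc d) :
    ‖∑ j, (2 * Real.pi * Complex.I * ξ j : ℂ) ^ 2‖ = (2 * Real.pi) ^ 2 * ‖ξ‖ ^ 2 := by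
  have h : ∑ j, (2 * Real.pi * Complex.I * ξ j : ℂ) ^ 2 =
      ((-((2 * Real.pi) ^ 2 * ‖ξ‖ ^ 2) : ℝ) : ℂ) := by
    rw [EuclideanSpace.real_norm_sq_eq]
    push_cast
    rw [Finset.mul_sum, ← Finset.sum_neg_distrib]
    refine Finset.sum_congr rfl fun j _ => ?_
    linear_combination (2 * Real.pi * ξ j : ℂ) ^ 2 * Complex.I_sq
  rw [h, Complex.norm_real, norm_neg, Real.norm_of_nonneg (by positivity)]

theorem gaussianCoeff_sq {σ : ℝ} (hσ : 0 < σ) (n : ℕ) :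
    gaussianCoeff σ n ^ 2 = 1 / ((n.factorial : ℝ) * 4 ^ n * σ ^ (2 * n)) :=
  Real.sq_sqrt (by positivity)

/-- The normalization of order `n` produces the `n`-th term of an exponential series. -/
theorem gaussianCoeff_sq_mul_pow {σ : ℝ} (hσ : 0 < σ) (n : ℕ) (r : ℝ) :
    gaussianCoeff σ n ^ 2 * ((2 * Real.pi) ^ 2 * r) ^ n =
      (Real.pi ^ 2 * r / σ ^ 2) ^ n / n.factorial := by
  rw [gaussianCoeff_sq hσ, div_pow, pow_mul σ 2 n, mul_pow 2 Real.pi 2, mul_assoc,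
    mul_pow _ _ n, show (2 : ℝ) ^ 2 = 4 by norm_num]
  field_simp
  rw [mul_pow, mul_pow, mul_assoc]

/-- The operators of even order contribute the series of `cosh t`, those of odd order the series of
`sinh t`, and the two add up to `exp t`. -/
theorem hasSum_norm_gaussianSymbol_sq {d : ℕ} {σ : ℝ} (hσ : 0 < σ) (ξ : Euc d) :
    HasSum (fun i => ‖gaussianSymbol d σ i ξ‖ ^ 2)
      (Real.exp (Real.pi ^ 2 * ‖ξ‖ ^ 2 / σ ^ 2)) := by
  set t : ℝ := Real.pi ^ 2 * ‖ξ‖ ^ 2 / σ ^ 2 with ht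
  have e1 : ∀ k, ‖gaussianSymbol d σ (Sum.inl k) ξ‖ ^ 2 = t ^ (2 * k) / (2 * k).factorial := by
    intro k
    rw [gaussianSymbol, norm_mul, norm_pow, norm_sum_sq_symbol, Complex.norm_real, mul_pow,
      Real.norm_eq_abs, sq_abs, ← gaussianCoeff_sq_mul_pow hσ, ← pow_mul, mul_comm k 2]
  have e2 : ∀ k j, ‖gaussianSymbol d σ (Sum.inr (k, j)) ξ‖ ^ 2 =
      (Real.pi ^ 2 / σ ^ 2 * (t ^ (2 * k) / (2 * k + 1).factorial)) * ξ j ^ 2 := by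
    intro k j
    have hn : ‖(2 * Real.pi * Complex.I * ξ j : ℂ)‖ ^ 2 = (2 * Real.pi) ^ 2 * ξ j ^ 2 := by
      simp [mul_pow]
    have hc : gaussianCoeff σ (2 * k + 1) ^ 2 * (2 * Real.pi) ^ 2 *
        ((2 * Real.pi) ^ 2 * ‖ξ‖ ^ 2) ^ (2 * k) =
        Real.pi ^ 2 / σ ^ 2 * (t ^ (2 * k) / (2 * k + 1).factorial) := by
      have h := fun r => gaussianCoeff_sq_mul_pow hσ (2 * k + 1) r
      -- The claim is the identity of order `2 * k + 1` divided by `‖ξ‖ ^ 2`. At `ξ = 0` it is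
      -- checked directly: both sides vanish unless `k = 0`, where `r = 1` gives it.
      by_cases hξ : ‖ξ‖ = 0
      · have h1 := h 1
        rcases k with _ | k
        · simp only [mul_zero, zero_add, pow_zero, mul_one, pow_one] at h1 ⊢
          rw [h1]; ring
        · simp [ht, hξ]
      · refine mul_right_cancel₀ (pow_ne_zero 2 hξ) ?_
        linear_combination h (‖ξ‖ ^ 2) + (t ^ (2 * k) / (2 * k + 1).factorial) * ht
    rw [← hc, gaussianSymbol, norm_mul, norm_mul, norm_pow, norm_sum_sq_symbol, Complex.norm_real,
      mul_pow, Real.norm_eq_abs, sq_abs, mul_pow _ ‖(2 * Real.pi * Complex.I * ξ j : ℂ)‖ 2, hn]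
    ring
  have h1 : HasSum (fun k => ‖gaussianSymbol d σ (Sum.inl k) ξ‖ ^ 2) (Real.cosh t) := by
    simp only [e1]
    exact Real.hasSum_cosh t
  have hs : HasSum (fun k : ℕ => t ^ (2 * k + 1) / (2 * k + 1).factorial) (Real.sinh t) :=
    Real.hasSum_sinh t
  have hfib : ∀ k, HasSum (fun j => ‖gaussianSymbol d σ (Sum.inr (k, j)) ξ‖ ^ 2)
      (t ^ (2 * k + 1) / (2 * k + 1).factorial) := by
    intro k
    simp only [e2]
    convert hasSum_fintype _ using 1
    -- Summing `ξ j ^ 2` over `j` gives `‖ξ‖ ^ 2`, which together with `π² / σ²` is the missing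
    -- factor `t`.
    rw [← Finset.mul_sum, ← EuclideanSpace.real_norm_sq_eq, pow_succ]
    nth_rw 2 [ht]
    field_simp
  have h2 : HasSum (fun kj => ‖gaussianSymbol d σ (Sum.inr kj) ξ‖ ^ 2) (Real.sinh t) := by
    have hsum : Summable (fun kj => ‖gaussianSymbol d σ (Sum.inr kj) ξ‖ ^ 2) := by
      rw [summable_prod_of_nonneg (fun _ => by positivity)]
      refine ⟨fun k => (hfib k).summable, ?_⟩
      simpa only [(hfib _).tsum_eq] using hs.summable
    have := hsum.hasSum.prod_fiberwise hfib
    rw [hs.unique this]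
    exact hsum.hasSum
  rw [← Real.cosh_add_sinh]
  exact h1.sum h2

/-! ### The Gaussian weight -/

/-- The square root of the Fourier transform of the Gaussian. -/
def gaussianWeight (d : ℕ) (σ : ℝ) (ξ : Euc d) : ℝ :=
  Real.exp (-(Real.pi ^ 2 / (2 * σ ^ 2)) * ‖ξ‖ ^ 2)

theorem gaussianWeight_pos {d : ℕ} {σ : ℝ} (ξ : Euc d) : 0 < gaussianWeight d σ ξ :=
  Real.exp_pos _

theorem gaussianWeight_le_one {d : ℕ} {σ : ℝ} (ξ : Euc d) : gaussianWeight d σ ξ ≤ 1 := by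
  rw [gaussianWeight, Real.exp_le_one_iff, neg_mul, neg_nonpos]
  positivity

@[fun_prop]
theorem continuous_gaussianWeight {d : ℕ} {σ : ℝ} : Continuous (gaussianWeight d σ) := by
  unfold gaussianWeight
  fun_prop

theorem gaussianWeight_sq_mul_exp {d : ℕ} {σ : ℝ} (ξ : Euc d) :
    gaussianWeight d σ ξ ^ 2 * Real.exp (Real.pi ^ 2 * ‖ξ‖ ^ 2 / σ ^ 2) = 1 := by
  rw [gaussianWeight, ← Real.exp_nat_mul, ← Real.exp_add, Real.exp_eq_one_iff]
  push_cast
  by_cases h : σ = 0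
  · simp [h]
  · field_simp; ring

/-- The weight exactly balances the growth of the symbols, so the weighted symbols are bounded
multipliers that jointly preserve inner products. -/
theorem hasSum_norm_gaussianSymbol_mul_weight_sq {d : ℕ} {σ : ℝ} (hσ : 0 < σ) (ξ : Euc d) :
    HasSum (fun i => ‖gaussianSymbol d σ i ξ * gaussianWeight d σ ξ‖ ^ 2) 1 := by
  have h := (hasSum_norm_gaussianSymbol_sq hσ ξ).mul_left (gaussianWeight d σ ξ ^ 2)
  rw [gaussianWeight_sq_mul_exp] at h
  refine h.congr_fun fun i => ?_
  rw [norm_mul, Complex.norm_real, mul_pow, Real.norm_eq_abs, sq_abs, mul_comm]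

theorem norm_gaussianSymbol_mul_weight_le_one {d : ℕ} {σ : ℝ} (hσ : 0 < σ) (i) (ξ : Euc d) :
    ‖gaussianSymbol d σ i ξ * gaussianWeight d σ ξ‖ ≤ 1 := by
  have h := le_hasSum (hasSum_norm_gaussianSymbol_mul_weight_sq hσ ξ) i fun _ _ => by positivity
  exact (sq_le_one_iff₀ (norm_nonneg _)).mp h

theorem gaussianWeight_sq_eq {d : ℕ} {σ : ℝ} (ξ : Euc d) :
    ((gaussianWeight d σ ξ ^ 2 : ℝ) : ℂ) = Complex.exp (-((Real.pi ^ 2 / σ ^ 2 : ℝ) : ℂ) * ‖ξ‖ ^ 2) := by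
  rw [gaussianWeight, ← Real.exp_nat_mul]
  push_cast
  congr 1
  by_cases h : (σ : ℂ) = 0
  · simp [h]
  · field_simp

theorem integrable_gaussianWeight_sq {d : ℕ} {σ : ℝ} (hσ : 0 < σ) :
    Integrable (fun ξ => gaussianWeight d σ ξ ^ 2) := by
  have h := GaussianFourier.integrable_cexp_neg_mul_sq_norm_add (V := Euc d)
    (b := ((Real.pi ^ 2 / σ ^ 2 : ℝ) : ℂ)) (by rw [Complex.ofReal_re]; positivity) 0 0
  have h' := h.re
  refine h'.congr (Filter.Eventually.of_forall fun ξ => ?_)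
  simp only [zero_mul, add_zero]
  rw [← gaussianWeight_sq_eq]
  exact Complex.ofReal_re _

theorem memLp_gaussianWeight {d : ℕ} {σ : ℝ} (hσ : 0 < σ) :
    MemLp (gaussianWeight d σ) 2 :=
  (memLp_two_iff_integrable_sq continuous_gaussianWeight.aestronglyMeasurable).mpr
    (integrable_gaussianWeight_sq hσ)

/-- The Gaussian formula with `b = π² / σ²`: here `π / b = σ² / π` gives the normalizing constant
and `π² / b = σ²` the exponent. -/
theorem fourier_gaussianWeight_sq {d : ℕ} {σ : ℝ} (hσ : 0 < σ) (x : Euc d) :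
    𝓕 (fun ξ => ((gaussianWeight d σ ξ ^ 2 : ℝ) : ℂ)) x = (gaussianFun d σ x : ℂ) := by
  simp only [gaussianWeight_sq_eq]
  rw [fourier_gaussian_innerProductSpace (by rw [Complex.ofReal_re]; positivity)]
  rw [gaussianFun]
  push_cast
  congr 1
  · have h1 : (Real.pi : ℂ) / (Real.pi ^ 2 / σ ^ 2) = ((σ ^ 2 / Real.pi : ℝ) : ℂ) := by
      have : (Real.pi : ℂ) ≠ 0 := by exact_mod_cast Real.pi_ne_zero
      have : (σ : ℂ) ≠ 0 := by exact_mod_cast hσ.ne'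
      push_cast
      field_simp
    have h2 : (σ ^ 2 / Real.pi) ^ ((d : ℝ) / 2) = σ ^ d / Real.pi ^ ((d : ℝ) / 2) := by
      rw [Real.div_rpow (by positivity) Real.pi_pos.le, ← Real.rpow_natCast σ 2,
        ← Real.rpow_mul hσ.le, ← Real.rpow_natCast σ d]
      congr 2
      push_cast
      ring
    rw [finrank_euclideanSpace_fin, h1]
    have h3 := congrArg (fun r : ℝ => (r : ℂ)) h2
    simp only [Complex.ofReal_cpow (show 0 ≤ σ ^ 2 / Real.pi by positivity)] at h3
    push_cast at h3 ⊢
    exact h3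
  · congr 1
    have : (σ : ℂ) ≠ 0 := by exact_mod_cast hσ.ne'
    field_simp

theorem gaussianFun_neg {d : ℕ} {σ : ℝ} (x : Euc d) : gaussianFun d σ (-x) = gaussianFun d σ x := by
  simp [gaussianFun]

theorem continuous_gaussianFun {d : ℕ} {σ : ℝ} : Continuous (gaussianFun d σ) := by
  unfold gaussianFun
  fun_prop

theorem memLp_mul_of_norm_le_one {d : ℕ} {m : Euc d → ℂ} (hm : Continuous m)
    (hb : ∀ ξ, ‖m ξ‖ ≤ 1) (u : Lp ℂ 2 (volume : Measure (Euc d))) :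
    MemLp (fun ξ => m ξ * u ξ) 2 := by
  refine (Lp.memLp u).of_le (hm.aestronglyMeasurable.mul (Lp.aestronglyMeasurable u))
    (Filter.Eventually.of_forall fun ξ => ?_)
  rw [norm_mul]
  exact mul_le_of_le_one_left (norm_nonneg _) (hb ξ)

/-- Fourier integrals use the complex inner product of `L²`, while maps from the real space `H` and
their adjoints use the real one. -/
theorem real_inner_eq_re_inner_Lp {d : ℕ} (f g : Lp ℂ 2 (volume : Measure (Euc d))) :
    inner ℝ f g = (inner ℂ f g : ℂ).re := by
  rw [L2.inner_def, L2.inner_def]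
  have h := integral_re (L2.integrable_inner (𝕜 := ℂ) f g)
  simpa using h

/-! ### Weighted characters and positive definiteness -/

variable {d : ℕ} {σ : ℝ}

/-- The exponential `ξ ↦ exp (-2πi ⟨ξ, x⟩)` times the weight `gaussianWeight d σ`. -/
def gaussianFeatureFun (d : ℕ) (σ : ℝ) (x ξ : Euc d) : ℂ :=
  Real.fourierChar (-inner ℝ ξ x) * gaussianWeight d σ ξ

@[fun_prop]
theorem continuous_gaussianFeatureFun (x : Euc d) : Continuous (gaussianFeatureFun d σ x) := by
  have h : Continuous fun ξ : Euc d => Real.fourierChar (-inner ℝ ξ x) :=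
    Real.continuous_fourierChar.comp (by fun_prop)
  unfold gaussianFeatureFun
  fun_prop

theorem memLp_gaussianFeatureFun (hσ : 0 < σ) (x : Euc d) :
    MemLp (gaussianFeatureFun d σ x) 2 := by
  refine (memLp_gaussianWeight hσ).of_le
    (continuous_gaussianFeatureFun x).aestronglyMeasurable
    (Filter.Eventually.of_forall fun ξ => ?_)
  rw [gaussianFeatureFun, norm_mul, Circle.norm_coe, one_mul, Complex.norm_real]

/-- The element of `L²` given by `gaussianFeatureFun d σ x`. -/
def gaussianFeature (hσ : 0 < σ) (x : Euc d) : Lp ℂ 2 (volume : Measure (Euc d)) :=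
  (memLp_gaussianFeatureFun hσ x).toLp _

theorem coeFn_gaussianFeature (hσ : 0 < σ) (x : Euc d) :
    gaussianFeature hσ x =ᵐ[volume] gaussianFeatureFun d σ x :=
  MemLp.coeFn_toLp _

/-- Conjugating the character yields the kernel of the inverse transform: pairing with a feature is
point evaluation. -/
theorem inner_gaussianFeature (hσ : 0 < σ) (x : Euc d) (u : Lp ℂ 2 (volume : Measure (Euc d))) :
    inner ℂ (gaussianFeature hσ x) u = 𝓕⁻ (fun ξ => (gaussianWeight d σ ξ : ℂ) * u ξ) x := by
  rw [L2.inner_def, Real.fourierInv_eq]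
  refine integral_congr_ae ?_
  filter_upwards [coeFn_gaussianFeature hσ x] with ξ hξ
  rw [hξ, RCLike.inner_apply, gaussianFeatureFun, map_mul, Complex.conj_ofReal, Circle.smul_def,
    smul_eq_mul, ← Circle.coe_inv_eq_conj, ← AddChar.map_neg_eq_inv, neg_neg]
  ring

theorem inner_gaussianFeature_gaussianFeature (hσ : 0 < σ) (x y : Euc d) :
    inner ℂ (gaussianFeature hσ x) (gaussianFeature hσ y) = (gaussianFun d σ (x - y) : ℂ) := by
  rw [inner_gaussianFeature, ← gaussianFun_neg, ← fourier_gaussianWeight_sq hσ, Real.fourierInv_eq,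
    Real.fourier_eq]
  refine integral_congr_ae ?_
  filter_upwards [coeFn_gaussianFeature hσ y] with ξ hξ
  rw [hξ, gaussianFeatureFun, neg_sub, inner_sub_right, neg_sub, sub_eq_add_neg,
    AddChar.map_add_eq_mul]
  simp only [Circle.smul_def, smul_eq_mul, Circle.coe_mul]
  push_cast
  ring

theorem real_inner_gaussianFeature (hσ : 0 < σ) (x y : Euc d) :
    inner ℝ (gaussianFeature hσ x) (gaussianFeature hσ y) = gaussianFun d σ (x - y) := by
  rw [real_inner_eq_re_inner_Lp, inner_gaussianFeature_gaussianFeature, Complex.ofReal_re]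

/-- The character `ξ ↦ exp (-2πi ⟨ξ, x⟩)` of `ℝ^d`, as a monoid homomorphism. -/
def charHom (x : Euc d) : Multiplicative (Euc d) →* ℂ where
  toFun ξ := Real.fourierChar (-inner ℝ ξ.toAdd x)
  map_one' := by simp
  map_mul' ξ η := by
    rw [toAdd_mul, inner_add_left, neg_add, AddChar.map_add_eq_mul, Circle.coe_mul]

theorem charHom_injective : Function.Injective (charHom (d := d)) := by
  intro x y h
  have hxy : ∀ t : ℝ, Real.fourierChar (t * ‖x - y‖ ^ 2) = 1 := by
    intro t
    have h' := DFunLike.congr_fun h (Multiplicative.ofAdd (t • (x - y)))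
    simp only [charHom, MonoidHom.coe_mk, OneHom.coe_mk, toAdd_ofAdd, Circle.coe_inj] at h'
    have e : t * ‖x - y‖ ^ 2 = -inner ℝ (t • (x - y)) y + -(-inner ℝ (t • (x - y)) x) := by
      rw [← real_inner_self_eq_norm_sq, inner_sub_right, inner_smul_left, inner_smul_left]
      simp
      ring
    rw [e, AddChar.map_add_eq_mul, AddChar.map_neg_eq_inv _ (-inner ℝ _ x), h', mul_inv_cancel]
  by_contra hne
  have hn : ‖x - y‖ ^ 2 ≠ 0 := pow_ne_zero 2 (norm_ne_zero_iff.mpr (sub_ne_zero.mpr hne))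
  -- This `t` makes the argument `1 / 2`, where the character is `exp (πi) = -1`.
  have h2 := congrArg (fun c : Circle => (c : ℂ)) (hxy (1 / 2 / ‖x - y‖ ^ 2))
  rw [div_mul_cancel₀ _ hn] at h2
  simp only [Real.fourierChar_apply] at h2
  have e : (2 * Real.pi * (1 / 2 : ℝ) : ℝ) = Real.pi := by ring
  rw [e, Complex.exp_pi_mul_I] at h2
  norm_num at h2

/-- A relation in `L²` holds everywhere by continuity. The nonvanishing weight cancels, and distinct
characters are independent (Dedekind). -/
theorem linearIndependent_gaussianFeature (hσ : 0 < σ) :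
    LinearIndependent ℝ (gaussianFeature (d := d) hσ) := by
  rw [linearIndependent_iff']
  intro s c hc
  have hcont : ∀ ξ, ∑ x ∈ s, (c x : ℂ) * gaussianFeatureFun d σ x ξ = 0 := by
    have h1 : (fun ξ => ∑ x ∈ s, (c x : ℂ) * gaussianFeatureFun d σ x ξ) =ᵐ[volume] fun _ => 0 := by
      have h2 := Lp.coeFn_zero ℂ 2 (volume : Measure (Euc d))
      rw [← hc] at h2
      have h3 : ∀ᵐ ξ, ∀ x ∈ s, (c x • gaussianFeature hσ x : Lp ℂ 2 (volume : Measure (Euc d))) ξ =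
          c x * gaussianFeatureFun d σ x ξ := by
        refine (Finset.eventually_all s).mpr fun x _ => ?_
        filter_upwards [coeFn_gaussianFeature hσ x, Lp.coeFn_smul (c x) (gaussianFeature hσ x)]
          with ξ h4 h5
        rw [h5, Pi.smul_apply, h4, Complex.real_smul]
      filter_upwards [h2, h3, Lp.coeFn_finsetSum s (fun x => c x • gaussianFeature hσ x)]
        with ξ h4 h5 h6
      rw [h6, Finset.sum_apply, Finset.sum_congr rfl h5] at h4
      exact h4
    exact congrFun (Continuous.ae_eq_iff_eq volume (by fun_prop) continuous_const |>.mp h1)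
  have hli := ((linearIndependent_monoidHom (Multiplicative (Euc d)) ℂ).comp _
    (charHom_injective (d := d)))
  rw [linearIndependent_iff'] at hli
  intro x hx
  have := hli s (fun x => (c x : ℂ)) ?_ x hx
  · exact_mod_cast this
  · ext ξ
    have h := hcont ξ.toAdd
    simp only [gaussianFeatureFun, ← mul_assoc, ← Finset.sum_mul] at h
    have hw : (gaussianWeight d σ ξ.toAdd : ℂ) ≠ 0 := by
      exact_mod_cast (gaussianWeight_pos _).ne'
    simpa [charHom] using (mul_eq_zero.mp h).resolve_right hw

/-- The quadratic form is the squared norm of a combination of features. -/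
theorem isPositiveDefiniteFunction_gaussianFun (hσ : 0 < σ) :
    IsPositiveDefiniteFunction (gaussianFun d σ) where
  continuous := continuous_gaussianFun
  even := gaussianFun_neg
  pos N x hx c hc := by
    have e : ∑ j, ∑ k, c j * c k * gaussianFun d σ (x j - x k) =
        ‖∑ j, c j • gaussianFeature hσ (x j)‖ ^ 2 := by
      rw [← real_inner_self_eq_norm_sq, sum_inner]
      refine Finset.sum_congr rfl fun j _ => ?_
      rw [inner_sum]
      refine Finset.sum_congr rfl fun k _ => ?_
      rw [real_inner_smul_left, real_inner_smul_right, real_inner_gaussianFeature, mul_assoc]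
    rw [e]
    have hli := (linearIndependent_gaussianFeature (d := d) hσ).comp x hx
    have : ∑ j, c j • gaussianFeature hσ (x j) ≠ 0 := fun h =>
      hc (funext (Fintype.linearIndependent_iff.mp hli c h))
    positivity

/-! ### The reproducing kernel Hilbert space and its embedding into `L²` -/

theorem translationKernel_apply (Φ : Euc d → ℝ) (x y : Euc d) (w : ℝ) :
    translationKernel Φ x y w = Φ (x - y) * w := rfl

theorem posSemidef_translationKernel_gaussianFun (hσ : 0 < σ) :
    (translationKernel (gaussianFun d σ)).PosSemidef := by
  have h := (RKHS.posSemidef_tfae (K := translationKernel (gaussianFun d σ))).out 0 2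
  refine h.mpr ⟨?_, fun c => ?_⟩
  · ext x y : 1
    refine ContinuousLinearMap.ext fun w => ext_inner_left ℝ fun v => ?_
    rw [Matrix.conjTranspose_apply, ContinuousLinearMap.star_eq_adjoint,
      ContinuousLinearMap.adjoint_inner_right, translationKernel_apply, translationKernel_apply,
      ← gaussianFun_neg, neg_sub]
    simp only [RCLike.inner_apply, conj_trivial]
    ring
  · have e : (c.sum fun x w => c.sum fun x' w' =>
        inner ℝ (translationKernel (gaussianFun d σ) x' x w) w') =
        ‖c.sum fun x w => w • gaussianFeature hσ x‖ ^ 2 := by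
      rw [← real_inner_self_eq_norm_sq, Finsupp.sum_inner]
      refine Finsupp.sum_congr fun x _ => ?_
      rw [Finsupp.inner_sum]
      refine Finsupp.sum_congr fun y _ => ?_
      rw [real_inner_smul_left, real_inner_smul_right, real_inner_gaussianFeature,
        ← gaussianFun_neg, neg_sub, translationKernel_apply, RCLike.inner_apply, conj_trivial]
      ring
    rw [e]
    simp

theorem exists_rkhs_gaussianFun (hσ : 0 < σ) :
    ∃ (H : Type) (_ : NormedAddCommGroup H) (_ : InnerProductSpace ℝ H) (_ : CompleteSpace H)
      (_ : RKHS ℝ H (Euc d) ℝ), RKHS.kernel H = translationKernel (gaussianFun d σ) :=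
  haveI : Fact (translationKernel (gaussianFun d σ)).PosSemidef :=
    ⟨posSemidef_translationKernel_gaussianFun hσ⟩
  ⟨RKHS.OfKernel (translationKernel (gaussianFun d σ)), inferInstance, inferInstance,
    inferInstance, inferInstance, RKHS.OfKernel.kernel_ofKernel⟩

/-- Two families with the same Gram matrix, the first of which has dense span, are related by a
continuous linear map. -/
theorem exists_clm_of_gram_eq {X H G : Type*} [NormedAddCommGroup H] [InnerProductSpace ℝ H]
    [NormedAddCommGroup G] [InnerProductSpace ℝ G] [CompleteSpace G] (v : X → H) (w : X → G)
    (hd : Dense (Submodule.span ℝ (Set.range v) : Set H))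
    (h : ∀ x y, inner ℝ (v x) (v y) = inner ℝ (w x) (w y)) :
    ∃ T : H →L[ℝ] G, ∀ x, T (v x) = w x := by
  -- Equal Gram matrices give equal norms of combinations, so `∑ c x • v x ↦ ∑ c x • w x` is
  -- isometric on a dense subspace and extends.
  have hn : ∀ c : X →₀ ℝ, ‖Finsupp.linearCombination ℝ w c‖ = ‖Finsupp.linearCombination ℝ v c‖ := by
    intro c
    rw [← sq_eq_sq₀ (norm_nonneg _) (norm_nonneg _), ← real_inner_self_eq_norm_sq,
      ← real_inner_self_eq_norm_sq, Finsupp.linearCombination_apply,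
      Finsupp.linearCombination_apply]
    simp only [Finsupp.sum, sum_inner, inner_sum, real_inner_smul_left, real_inner_smul_right, h]
  have hd' : DenseRange (Finsupp.linearCombination ℝ v) := by
    rw [← Finsupp.range_linearCombination] at hd
    exact hd
  refine ⟨(Finsupp.linearCombination ℝ w).extendOfNorm (Finsupp.linearCombination ℝ v),
    fun x => ?_⟩
  have := LinearMap.extendOfNorm_eq hd' ⟨1, fun c => by rw [hn, one_mul]⟩ (Finsupp.single x (1 : ℝ))
  simpa using this


section RKHS

variable {H : Type*} [NormedAddCommGroup H] [InnerProductSpace ℝ H] [CompleteSpace H]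
  [RKHS ℝ H (Euc d) ℝ]

theorem dense_span_kerFun_one :
    Dense (Submodule.span ℝ (Set.range fun x : Euc d => RKHS.kerFun H x (1 : ℝ)) : Set H) := by
  rw [Submodule.dense_iff_topologicalClosure_eq_top, ← RKHS.kerFun_dense H]
  congr 1
  refine le_antisymm (Submodule.span_mono ?_) (Submodule.span_le.mpr ?_)
  · rintro _ ⟨x, rfl⟩
    exact ⟨x, 1, rfl⟩
  · rintro _ ⟨x, c, rfl⟩
    have : RKHS.kerFun H x c = c • RKHS.kerFun H x (1 : ℝ) := by
      rw [← map_smul, smul_eq_mul, mul_one]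
    rw [this]
    exact Submodule.smul_mem _ _ (Submodule.subset_span ⟨x, rfl⟩)

/-- A Hilbert space with the Gaussian reproducing kernel embeds isometrically into `L²` on the
frequency side. -/
theorem exists_gaussian_embedding (hσ : 0 < σ)
    (hK : RKHS.kernel H = translationKernel (gaussianFun d σ)) :
    ∃ T : H →L[ℝ] Lp ℂ 2 (volume : Measure (Euc d)),
      (∀ x, T (RKHS.kerFun H x (1 : ℝ)) = gaussianFeature hσ x) ∧
      (∀ h x, inner ℂ (gaussianFeature hσ x) (T h) = (h x : ℂ)) ∧
      ∀ g h, inner ℂ (T g) (T h) = ((inner ℝ g h : ℝ) : ℂ) := by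
  obtain ⟨T, hT⟩ := exists_clm_of_gram_eq (fun x : Euc d => RKHS.kerFun H x (1 : ℝ))
    (gaussianFeature hσ) dense_span_kerFun_one fun x y => by
      rw [RKHS.kerFun_inner, RKHS.kerFun_apply, hK, translationKernel_apply,
        real_inner_gaussianFeature]
      simp
  have h1 : ∀ h x, inner ℂ (gaussianFeature hσ x) (T h) = (h x : ℂ) := by
    intro h x
    -- Both sides are continuous and real linear in `h`, so they need only agree on kernel
    -- functions, where the kernel values are real.
    have e : ((innerSL ℂ (gaussianFeature hσ x)).restrictScalars ℝ).comp T =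
        Complex.ofRealCLM.comp (innerSL ℝ (RKHS.kerFun H x (1 : ℝ))) := by
      refine ContinuousLinearMap.ext_on dense_span_kerFun_one ?_
      rintro _ ⟨y, rfl⟩
      simp only [ContinuousLinearMap.comp_apply, ContinuousLinearMap.coe_restrictScalars',
        innerSL_apply_apply, Complex.ofRealCLM_apply]
      rw [hT, inner_gaussianFeature_gaussianFeature, RKHS.kerFun_inner, RKHS.kerFun_apply, hK,
        translationKernel_apply]
      simp
    have := DFunLike.congr_fun e h
    simp only [ContinuousLinearMap.comp_apply, ContinuousLinearMap.coe_restrictScalars',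
      innerSL_apply_apply, Complex.ofRealCLM_apply, RKHS.kerFun_inner] at this
    simpa using this
  refine ⟨T, hT, h1, fun g h => ?_⟩
  have e : ((innerSL ℂ (T g)).restrictScalars ℝ).comp T = Complex.ofRealCLM.comp (innerSL ℝ g) := by
    refine ContinuousLinearMap.ext_on dense_span_kerFun_one ?_
    rintro _ ⟨y, rfl⟩
    simp only [ContinuousLinearMap.comp_apply, ContinuousLinearMap.coe_restrictScalars',
      innerSL_apply_apply, Complex.ofRealCLM_apply]
    rw [hT, ← inner_conj_symm, h1, RKHS.inner_kerFun, Complex.conj_ofReal]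
    simp
  exact DFunLike.congr_fun e h

end RKHS

/-! ### The generalized Sobolev space on the frequency side -/

/-- The product of `u ∈ L²` with `gaussianWeight d σ`. -/
def weightMul (σ : ℝ) (u : Lp ℂ 2 (volume : Measure (Euc d))) :
    Lp ℂ 2 (volume : Measure (Euc d)) :=
  (memLp_mul_of_norm_le_one (m := fun ξ => (gaussianWeight d σ ξ : ℂ)) (by fun_prop) (fun ξ => by
    rw [Complex.norm_real, Real.norm_of_nonneg (gaussianWeight_pos ξ).le]
    exact gaussianWeight_le_one ξ) u).toLp _

theorem coeFn_weightMul (u : Lp ℂ 2 (volume : Measure (Euc d))) :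
    weightMul σ u =ᵐ[volume] fun ξ => (gaussianWeight d σ ξ : ℂ) * u ξ :=
  MemLp.coeFn_toLp _

theorem integrable_weight_mul (hσ : 0 < σ) (u : Lp ℂ 2 (volume : Measure (Euc d))) :
    Integrable fun ξ => (gaussianWeight d σ ξ : ℂ) * u ξ :=
  MemLp.integrable_mul (memLp_gaussianWeight hσ).ofReal (Lp.memLp u)

theorem continuous_inner_gaussianFeature (hσ : 0 < σ) (u : Lp ℂ 2 (volume : Measure (Euc d))) :
    Continuous fun x => (inner ℂ (gaussianFeature hσ x) u : ℂ) := by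
  simp only [inner_gaussianFeature]
  exact continuous_fourierInv_of_integrable (integrable_weight_mul hσ u)

/-- As `w * u` lies in `L¹ ∩ L²`, its `L²` inverse transform has the Fourier integral as a
continuous representative. -/
theorem coeFn_fourierInv_weightMul (hσ : 0 < σ) (u : Lp ℂ 2 (volume : Measure (Euc d))) :
    ((𝓕⁻ (weightMul σ u) : Lp ℂ 2 (volume : Measure (Euc d))) : Euc d → ℂ) =ᵐ[volume]
      fun x => inner ℂ (gaussianFeature hσ x) u := by
  refine (coeFn_fourierInv_ae_eq _ ((integrable_weight_mul hσ u).congr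
    (coeFn_weightMul u).symm)).trans (Filter.Eventually.of_forall fun x => ?_)
  simp only [inner_gaussianFeature, Real.fourierInv_eq]
  refine integral_congr_ae ?_
  filter_upwards [coeFn_weightMul (σ := σ) u] with ξ hξ
  rw [hξ]

/-- The product of `u ∈ L²` with `gaussianSymbol d σ i * gaussianWeight d σ`. -/
def symbolMul (hσ : 0 < σ) (i : ℕ ⊕ (ℕ × Fin d)) (u : Lp ℂ 2 (volume : Measure (Euc d))) :
    Lp ℂ 2 (volume : Measure (Euc d)) :=
  (memLp_mul_of_norm_le_one (m := fun ξ => gaussianSymbol d σ i ξ * gaussianWeight d σ ξ)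
    ((hasFourierSymbol_gaussianOps d σ i).1.1.continuous.mul (by fun_prop))
    (norm_gaussianSymbol_mul_weight_le_one hσ i) u).toLp _

theorem coeFn_symbolMul (hσ : 0 < σ) (i : ℕ ⊕ (ℕ × Fin d))
    (u : Lp ℂ 2 (volume : Measure (Euc d))) :
    symbolMul hσ i u =ᵐ[volume] fun ξ => gaussianSymbol d σ i ξ * gaussianWeight d σ ξ * u ξ :=
  MemLp.coeFn_toLp _

/-- Pointwise the squared weighted symbols sum to one, so dominated convergence applies with total
bound `‖⟨u ξ, v ξ⟩‖`. -/
theorem hasSum_inner_symbolMul (hσ : 0 < σ) (u v : Lp ℂ 2 (volume : Measure (Euc d))) :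
    HasSum (fun i => inner ℂ (symbolMul hσ i u) (symbolMul hσ i v) : _ → ℂ) (inner ℂ u v) := by
  have hint : ∀ i, (inner ℂ (symbolMul hσ i u) (symbolMul hσ i v) : ℂ) =
      ∫ ξ, ((‖gaussianSymbol d σ i ξ * gaussianWeight d σ ξ‖ ^ 2 : ℝ) : ℂ) * inner ℂ (u ξ) (v ξ) := by
    intro i
    rw [L2.inner_def]
    refine integral_congr_ae ?_
    filter_upwards [coeFn_symbolMul hσ i u, coeFn_symbolMul hσ i v] with ξ h1 h2
    rw [h1, h2, Complex.ofReal_pow, ← Complex.mul_conj']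
    simp only [RCLike.inner_apply, map_mul]
    ring
  simp only [hint]
  rw [L2.inner_def]
  refine hasSum_integral_of_dominated_convergence
    (fun i ξ => ‖gaussianSymbol d σ i ξ * gaussianWeight d σ ξ‖ ^ 2 * ‖(inner ℂ (u ξ) (v ξ) : ℂ)‖)
    (fun i => ?_) (fun i => ?_) ?_ ?_ ?_
  · refine AEStronglyMeasurable.mul ?_ (L2.integrable_inner u v).aestronglyMeasurable
    have := (hasFourierSymbol_gaussianOps d σ i).1.1.continuous
    exact (by fun_prop : Continuous fun ξ =>
      ((‖gaussianSymbol d σ i ξ * gaussianWeight d σ ξ‖ ^ 2 : ℝ) : ℂ)).aestronglyMeasurable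
  · refine Filter.Eventually.of_forall fun ξ => ?_
    rw [norm_mul, Complex.norm_real, Real.norm_of_nonneg (by positivity)]
  · exact Filter.Eventually.of_forall fun ξ =>
      (hasSum_norm_gaussianSymbol_mul_weight_sq hσ ξ).summable.mul_right _
  · simp only [tsum_mul_right, (hasSum_norm_gaussianSymbol_mul_weight_sq hσ _).tsum_eq, one_mul]
    exact (L2.integrable_inner u v).norm
  · refine Filter.Eventually.of_forall fun ξ => ?_
    have h := (Complex.hasSum_ofReal.mpr (hasSum_norm_gaussianSymbol_mul_weight_sq hσ ξ)).mul_right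
      (inner ℂ (u ξ) (v ξ) : ℂ)
    simpa using h

theorem gaussianOps_realToDistr (hσ : 0 < σ) {f : Lp ℝ 2 (volume : Measure (Euc d))}
    {u : Lp ℂ 2 (volume : Measure (Euc d))}
    (hf : Complex.ofRealCLM.compLp f = 𝓕⁻ (weightMul σ u)) (i : ℕ ⊕ (ℕ × Fin d)) :
    Lp.toTemperedDistributionCLM ℂ volume 2 (𝓕⁻ (symbolMul hσ i u)) =
      (gaussianOps d σ i : Module.End ℂ 𝓢'(Euc d, ℂ)) (realToDistr f) := by
  rw [realToDistr, hf, Lp.toTemperedDistributionCLM_apply, Lp.toTemperedDistributionCLM_apply,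
    (hasFourierSymbol_gaussianOps d σ i).apply_eq_iff, FourierTransform.fourier_fourierInv_eq,
    FourierTransform.fourier_fourierInv_eq]
  filter_upwards [coeFn_symbolMul hσ i u, coeFn_weightMul (σ := σ) u] with ξ h1 h2
  rw [h1, h2, mul_assoc]

theorem mem_genSobolev_of_eq (hσ : 0 < σ) {f : Lp ℝ 2 (volume : Measure (Euc d))}
    {u : Lp ℂ 2 (volume : Measure (Euc d))}
    (hf : Complex.ofRealCLM.compLp f = 𝓕⁻ (weightMul σ u)) :
    f ∈ genSobolev (gaussianOps d σ) := by
  refine ⟨fun i => 𝓕⁻ (symbolMul hσ i u), gaussianOps_realToDistr hσ hf, ?_⟩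
  have h := Complex.hasSum_re (hasSum_inner_symbolMul hσ u u)
  refine h.summable.congr fun i => ?_
  have e : ‖𝓕⁻ (symbolMul hσ i u)‖ = ‖symbolMul hσ i u‖ :=
    (Lp.fourierTransformₗᵢ (Euc d) ℂ).symm.norm_map _
  rw [e, inner_self_eq_norm_sq_to_K]
  norm_cast

/-- Plancherel for each `i`, then summation. The order of `u` and `v` is reversed because `inner` is
conjugate linear in its first argument. -/
theorem genSobolevInner_eq (hσ : 0 < σ) {f g : genSobolev (gaussianOps d σ)}
    {u v : Lp ℂ 2 (volume : Measure (Euc d))}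
    (hf : Complex.ofRealCLM.compLp f.1 = 𝓕⁻ (weightMul σ u))
    (hg : Complex.ofRealCLM.compLp g.1 = 𝓕⁻ (weightMul σ v)) :
    genSobolevInner (gaussianOps d σ) f g = inner ℂ v u := by
  rw [← (hasSum_inner_symbolMul hσ v u).tsum_eq, genSobolevInner]
  refine tsum_congr fun i => ?_
  rw [← gaussianOps_realToDistr hσ hf, ← gaussianOps_realToDistr hσ hg,
    l2Rep_toTemperedDistribution, l2Rep_toTemperedDistribution]
  have e : (inner ℂ (𝓕⁻ (symbolMul hσ i v)) (𝓕⁻ (symbolMul hσ i u)) : ℂ) =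
      inner ℂ (symbolMul hσ i v) (symbolMul hσ i u) :=
    (Lp.fourierTransformₗᵢ (Euc d) ℂ).symm.inner_map_map _ _
  rw [← e, L2.inner_def]
  rfl

theorem integral_norm_sq_Lp (f : Lp ℂ 2 (volume : Measure (Euc d))) :
    ∫ x, ‖f x‖ ^ 2 = ‖f‖ ^ 2 := by
  have h := real_inner_self_eq_norm_sq f
  rw [L2.inner_def] at h
  simpa only [real_inner_self_eq_norm_sq] using h

/-- The candidate is `u = w⁻¹ * 𝓕 f`. Since `w⁻² = ∑ ‖p i‖ ^ 2`, Tonelli and Plancherel give `‖u‖ ^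
2 = ∑ ‖P i f‖ ^ 2`, which is finite. -/
theorem exists_eq_fourierInv_weightMul (hσ : 0 < σ) {f : Lp ℝ 2 (volume : Measure (Euc d))}
    (hf : f ∈ genSobolev (gaussianOps d σ)) :
    ∃ u, Complex.ofRealCLM.compLp f = 𝓕⁻ (weightMul σ u) := by
  obtain ⟨g, hg, hs⟩ := hf
  set q : Lp ℂ 2 (volume : Measure (Euc d)) := 𝓕 (Complex.ofRealCLM.compLp f) with hq
  have hgq : ∀ i, ((𝓕 (g i) : Lp ℂ 2 (volume : Measure (Euc d))) : Euc d → ℂ) =ᵐ[volume]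
      fun ξ => gaussianSymbol d σ i ξ * q ξ := fun i =>
    ((hasFourierSymbol_gaussianOps d σ i).apply_eq_iff _ _).mp (hg i)
  have hmeas : AEStronglyMeasurable (fun ξ => ((gaussianWeight d σ ξ)⁻¹ : ℂ) * q ξ) := by
    refine AEStronglyMeasurable.mul (Continuous.aestronglyMeasurable ?_) (Lp.aestronglyMeasurable q)
    exact Continuous.inv₀ (by fun_prop) fun ξ => by exact_mod_cast (gaussianWeight_pos ξ).ne'
  have hmem : MemLp (fun ξ => ((gaussianWeight d σ ξ)⁻¹ : ℂ) * q ξ) 2 := by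
    rw [memLp_two_iff_integrable_sq_norm hmeas]
    refine ⟨(hmeas.norm.pow 2), ?_⟩
    rw [hasFiniteIntegral_iff_ofReal (Filter.Eventually.of_forall fun _ => by positivity)]
    have e1 : ∀ᵐ ξ, ENNReal.ofReal (‖((gaussianWeight d σ ξ)⁻¹ : ℂ) * q ξ‖ ^ 2) =
        ∑' i, ENNReal.ofReal (‖(𝓕 (g i) : Lp ℂ 2 (volume : Measure (Euc d))) ξ‖ ^ 2) := by
      filter_upwards [MeasureTheory.ae_all_iff.mpr hgq] with ξ hξ
      have h := (hasSum_norm_gaussianSymbol_sq hσ ξ).mul_right (‖q ξ‖ ^ 2)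
      simp only [hξ, norm_mul, mul_pow]
      rw [← ENNReal.ofReal_tsum_of_nonneg (fun i => by positivity) h.summable, h.tsum_eq]
      congr 2
      rw [norm_inv, Complex.norm_real, Real.norm_of_nonneg (gaussianWeight_pos ξ).le, inv_pow]
      exact inv_eq_of_mul_eq_one_right (gaussianWeight_sq_mul_exp ξ)
    rw [lintegral_congr_ae e1, lintegral_tsum
      (f := fun i ξ => ENNReal.ofReal (‖(𝓕 (g i) : Lp ℂ 2 (volume : Measure (Euc d))) ξ‖ ^ 2))
      fun i => ((Lp.aestronglyMeasurable _).norm.pow 2).aemeasurable.ennreal_ofReal]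
    have e2 : ∀ i, ∫⁻ ξ, ENNReal.ofReal (‖(𝓕 (g i) : Lp ℂ 2 (volume : Measure (Euc d))) ξ‖ ^ 2) =
        ENNReal.ofReal (‖g i‖ ^ 2) := by
      intro i
      rw [← Lp.norm_fourier_eq (g i), ← ofReal_integral_eq_lintegral_ofReal
        ((memLp_two_iff_integrable_sq_norm (Lp.aestronglyMeasurable _)).mp (Lp.memLp _))
        (Filter.Eventually.of_forall fun _ => by positivity)]
      rw [integral_norm_sq_Lp]
    simp only [e2]
    rw [← ENNReal.ofReal_tsum_of_nonneg (fun i => by positivity) hs]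
    exact ENNReal.ofReal_lt_top
  refine ⟨hmem.toLp _, ?_⟩
  have : weightMul σ (hmem.toLp _) = q := by
    refine Lp.ext ?_
    filter_upwards [coeFn_weightMul (σ := σ) (hmem.toLp _), hmem.coeFn_toLp] with ξ h1 h2
    rw [h1, h2, ← mul_assoc, mul_inv_cancel₀, one_mul]
    exact_mod_cast (gaussianWeight_pos ξ).ne'
  rw [this, hq, FourierTransform.fourierInv_fourier_eq]

/-! ### Identification of the two spaces -/

theorem exists_linearEquiv_genSobolev {H : Type*} [NormedAddCommGroup H] [InnerProductSpace ℝ H]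
    [CompleteSpace H] [RKHS ℝ H (Euc d) ℝ] (hσ : 0 < σ)
    (hK : RKHS.kernel H = translationKernel (gaussianFun d σ)) :
    (∀ h : H, Continuous h) ∧
      ∃ J : H ≃ₗ[ℝ] genSobolev (gaussianOps d σ),
        (∀ h : H, ((J h : Lp ℝ 2 (volume : Measure (Euc d))) : Euc d → ℝ) =ᵐ[volume] h) ∧
        (∀ g h : H, ((inner ℝ g h : ℝ) : ℂ) = genSobolevInner (gaussianOps d σ) (J g) (J h)) := by
  obtain ⟨T, hT, hTx, hTi⟩ := exists_gaussian_embedding hσ hK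
  have hcont : ∀ h : H, Continuous h := fun h => by
    have := Complex.continuous_re.comp (continuous_inner_gaussianFeature hσ (T h))
    simpa only [Function.comp_def, hTx, Complex.ofReal_re] using this
  have hae : ∀ h : H,
      ((𝓕⁻ (weightMul σ (T h)) : Lp ℂ 2 (volume : Measure (Euc d))) : Euc d → ℂ) =ᵐ[volume]
        fun x => (h x : ℂ) := fun h => by
    simpa only [hTx] using coeFn_fourierInv_weightMul hσ (T h)
  have hmem : ∀ h : H, MemLp (h : Euc d → ℝ) 2 := fun h =>
    ((memLp_congr_ae (hae h)).mp (Lp.memLp _)).re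
  have hcomp : ∀ h : H, Complex.ofRealCLM.compLp ((hmem h).toLp _) = 𝓕⁻ (weightMul σ (T h)) := by
    intro h
    refine Lp.ext ?_
    filter_upwards [Complex.ofRealCLM.coeFn_compLp ((hmem h).toLp _), (hmem h).coeFn_toLp, hae h]
      with x h1 h2 h3
    rw [h1, h2, h3, Complex.ofRealCLM_apply]
  let J : H →ₗ[ℝ] genSobolev (gaussianOps d σ) :=
    { toFun := fun h => ⟨(hmem h).toLp _, mem_genSobolev_of_eq hσ (hcomp h)⟩
      map_add' := fun g h => Subtype.ext <|
        (MemLp.toLp_congr (hmem (g + h)) ((hmem g).add (hmem h)) (by rw [RKHS.coe_add])).trans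
          (MemLp.toLp_add (hmem g) (hmem h))
      map_smul' := fun c h => Subtype.ext <|
        (MemLp.toLp_congr (hmem (c • h)) ((hmem h).const_smul c) (by rw [RKHS.coe_smul])).trans
          (MemLp.toLp_const_smul c (hmem h)) }
  have hJ : ∀ h : H, ((J h : Lp ℝ 2 (volume : Measure (Euc d))) : Euc d → ℝ) =ᵐ[volume] h :=
    fun h => (hmem h).coeFn_toLp
  have hinj : Function.Injective J := by
    intro g h hgh
    have h1 : (g : Euc d → ℝ) =ᵐ[volume] h := (hJ g).symm.trans (hgh ▸ hJ h)
    exact DFunLike.coe_injective ((hcont g).ae_eq_iff_eq volume (hcont h) |>.mp h1)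
  have hsurj : Function.Surjective J := by
    rintro ⟨f, hf⟩
    obtain ⟨u, hu⟩ := exists_eq_fourierInv_weightMul hσ hf
    -- By the reproducing property the value of the adjoint at `x` is the real inner product of the
    -- feature at `x` with `u`, that is, the real part of `𝓕⁻ (w * u)` at `x`; and `f` is real.
    refine ⟨ContinuousLinearMap.adjoint T u, Subtype.ext (Lp.ext ?_)⟩
    have hval : ∀ x, (ContinuousLinearMap.adjoint T u) x =
        (inner ℂ (gaussianFeature hσ x) u : ℂ).re := by
      intro x
      rw [← real_inner_eq_re_inner_Lp, ← hT, ← ContinuousLinearMap.adjoint_inner_right,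
        RKHS.kerFun_inner]
      simp
    have h2 := coeFn_fourierInv_weightMul hσ u
    rw [← hu] at h2
    filter_upwards [hJ (ContinuousLinearMap.adjoint T u), h2, Complex.ofRealCLM.coeFn_compLp f]
      with x h3 h4 h5
    rw [h3, hval, ← h4, h5, Complex.ofRealCLM_apply, Complex.ofReal_re]
  refine ⟨hcont, LinearEquiv.ofBijective J ⟨hinj, hsurj⟩, hJ, fun g h => ?_⟩
  refine Eq.symm ((genSobolevInner_eq hσ (hcomp g) (hcomp h)).trans ?_)
  rw [hTi, real_inner_comm]

end

theorem mainTheorem3 (d : ℕ) (σ : ℝ) (hσ : 0 < σ) :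
    IsPositiveDefiniteFunction (gaussianFun d σ) ∧
    (∃ (H : Type) (_ : NormedAddCommGroup H) (_ : InnerProductSpace ℝ H) (_ : CompleteSpace H)
      (_ : RKHS ℝ H (Euc d) ℝ), RKHS.kernel H = translationKernel (gaussianFun d σ)) ∧
    (∀ (H : Type*) [NormedAddCommGroup H] [InnerProductSpace ℝ H] [CompleteSpace H]
      [RKHS ℝ H (Euc d) ℝ], RKHS.kernel H = translationKernel (gaussianFun d σ) →
      (∀ h : H, Continuous h) ∧
      ∃ J : H ≃ₗ[ℝ] genSobolev (gaussianOps d σ),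
        (∀ h : H, ((J h : Lp ℝ 2 (volume : Measure (Euc d))) : Euc d → ℝ) =ᵐ[volume] h) ∧
        (∀ g h : H, ((inner ℝ g h : ℝ) : ℂ) = genSobolevInner (gaussianOps d σ) (J g) (J h))) :=
  ⟨isPositiveDefiniteFunction_gaussianFun hσ, exists_rkhs_gaussianFun hσ,
    fun _ => exists_linearEquiv_genSobolev hσ⟩
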